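/- Let $k\ge 1$. In a simultaneous first-price auction with bidders $[n]$ and items $M=[m]$, every bidder $i$ submits a bid $b_{ij}\ge 0$ on every item $j$; every item is allocated to a bidder whose bid on it is highest, ties being broken arbitrarily (possibly at random), and the winner of an item pays her bid on it. A bidder with valuation $v_i:2^M\to\mathbb{R}_{\ge 0}$ has utility $u_i(b;v_i)=v_i(X_i(b))-\sum_{j\in X_i(b)}b_{ij}$, where $X_i(b)$ is the bundle she wins. A set function $v:2^M\to\mathbb{R}_{\ge 0}$ is $\mathcal{PH}$-$k$ if $v(S)=\sum_{T\subseteq S}h(T)$ for all $S$, for some $h\ge 0$ with $h(\emptyset)=0$ and $h(T)=0$ whenever $|T|>k$; a monotone set function $v$ is $\mathcal{MPH}$-$k$ if there is a family $(v_\ell)_{\ell\in\mathcal L}$ of $\mathcal{PH}$-$k$ functions with $v(S)=\max_{\ell\in\mathcal L}v_\ell(S)$ for all $S\subseteq M$. Write $\mathrm{OPT}(v)$ for the maximum of the social welfare $\sum_i v_i(X_i)$ over all allocations $X$. The correlated price of anarchy is the supremum, over all valuation profiles $v$ of $\mathcal{MPH}$-$k$ functions and all correlated equilibria $B$ (joint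 laws of bid profiles such that no bidder can increase her expected utility by replacing her recommended bid vector by a function of it), of $$\frac{\mathrm{OPT}(v)}{\mathbb{E}_{b\sim B}\left[\sum_i v_i(X_i(b))\right]}.$$ The Bayes-Nash price of anarchy is the supremum, over all product distributions $F=F_1\times\dots\times F_n$ on profiles of $\mathcal{MPH}$-$k$ valuations and all (mixed) Bayes-Nash equilibria (strategies $\sigma_i$ mapping the own valuation to a law of the own bid vector such that, for $F_i$-almost every own valuation, no bidder $i$ can increase her conditional expected utility by another bid vector), of $$\frac{\mathbb{E}_{v\sim F}[\mathrm{OPT}(v)]}{\mathbb{E}_{v\sim F}\,\mathbb{E}_{b\sim\sigma(v)}\left[\sum_i v_i(X_i(b))\right]}.$$ Here $x/0=\infty$ for $x>0$, and the indeterminate ratios $0/0$ and $\infty/\infty$ are disregarded. Then, for every simultaneous first-price auction, both the correlated price of anarchy and the Bayes-Nash price of anarchy for $\mathcal{MPH}$-$k$ bidders are at most $2k$. -/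

import Mathlib

open MeasureTheory ProbabilityTheory
open scoped NNReal ENNReal

noncomputable section

namespace ItemAuction

/-! ### Valuations -/

/-- A set function `2^[m] → ℝ⁺` on the items `[m]`. -/
abbrev Valuation (m : ℕ) : Type := Finset (Fin m) → ℝ≥0

/-- `h` is a hypergraph representation of `v`: it is normalized (not necessarily monotone or
nonnegative), and `v S` is the sum of the weights `h T` of all `T ⊆ S`. -/
def IsHypergraphRep {m : ℕ} (v : Valuation m) (h : Finset (Fin m) → ℝ) : Prop :=
  h ∅ = 0 ∧ ∀ S, (v S : ℝ) = ∑ T ∈ S.powerset, h T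

/-- Positive hypergraph functions of rank at most `k`: all weights are nonnegative, and every
hyperedge (set of nonzero weight) has at most `k` elements. -/
def IsPH {m : ℕ} (k : ℕ) (v : Valuation m) : Prop :=
  ∃ h : Finset (Fin m) → ℝ,
    IsHypergraphRep v h ∧ (∀ S, 0 ≤ h S) ∧ ∀ S, h S ≠ 0 → S.card ≤ k

/-- Monotone set functions that are the pointwise maximum of a family of `PH`-`k` functions. -/
def IsMPH {m : ℕ} (k : ℕ) (v : Valuation m) : Prop :=
  Monotone v ∧ ∃ L : Set (Valuation m),
    (∀ f ∈ L, IsPH k f) ∧ ∀ S, IsGreatest ((fun f : Valuation m => f S) '' L) (v S)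

/-! ### Allocations and welfare -/

/-- An allocation assigns every item to a bidder. -/
abbrev Allocation (n m : ℕ) : Type := Fin m → Fin n

/-- The bundle allocated to bidder `i`. -/
def bundle {n m : ℕ} (X : Allocation n m) (i : Fin n) : Finset (Fin m) :=
  Finset.univ.filter fun j => X j = i

/-- The social welfare of an allocation. -/
def welfare {n m : ℕ} (v : Fin n → Valuation m) (X : Allocation n m) : ℝ≥0 :=
  ∑ i, v i (bundle X i)

/-- The maximum welfare over all allocations. -/
def optWelfare {n m : ℕ} (v : Fin n → Valuation m) : ℝ≥0 :=
  Finset.univ.sup fun X : Allocation n m => welfare v X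

/-! ### The simultaneous first-price auction -/

/-- The vector of bids of one bidder, one nonnegative bid for each item. -/
abbrev Bid (m : ℕ) : Type := Fin m → ℝ≥0

/-- The bids of all bidders. -/
abbrev BidProfile (n m : ℕ) : Type := Fin n → Bid m

/-- An allocation rule of the auction: every item goes to a bidder whose bid on it is highest.
Ties are broken arbitrarily: possibly at random, possibly in a correlated way across items, and
possibly depending on the whole bid profile. -/
structure AllocationRule (n m : ℕ) where
  /-- The law of the allocation, given the bid profile. -/
  law : Kernel (BidProfile n m) (Allocation n m)
  isMarkov : IsMarkovKernel law
  highest : ∀ b, ∀ᵐ X ∂(law b), ∀ j i, b i j ≤ b (X j) j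

/-- The quasi-linear utility of bidder `i`, who has valuation `v`, at the bid profile `b`, in
expectation over the tie-breaking: the value of the bundle won minus the bids on the items won. -/
def utility {n m : ℕ} (A : AllocationRule n m) (i : Fin n) (v : Valuation m)
    (b : BidProfile n m) : ℝ :=
  ∫ X, ((v (bundle X i) : ℝ) - ∑ j ∈ bundle X i, (b i j : ℝ)) ∂(A.law b)

/-! ### Correlated equilibria (full information) -/

/-- The joint law `B` of the bid profile is a correlated equilibrium: no bidder can gain by
replacing the bid vector recommended to her by a function of it.

Utilities are bounded above, so expected utilities exist in `[-∞, ∞)`. A bidder gets at least `0`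
by bidding zero, hence equilibrium utilities are finite; a deviation whose utility is not
integrable has expected utility `-∞` and is not profitable. -/
def IsCorrelatedEq {n m : ℕ} (A : AllocationRule n m) (v : Fin n → Valuation m)
    (B : Measure (BidProfile n m)) : Prop :=
  IsProbabilityMeasure B ∧
  ∀ i, Integrable (fun b => utility A i (v i) b) B ∧
    ∀ φ : Bid m → Bid m, Measurable φ →
      Integrable (fun b => utility A i (v i) (Function.update b i (φ (b i)))) B →
      ∫ b, utility A i (v i) (Function.update b i (φ (b i))) ∂B
        ≤ ∫ b, utility A i (v i) b ∂B

/-- The expected welfare when the bid profile has law `B`. -/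
def expWelfare {n m : ℕ} (A : AllocationRule n m) (v : Fin n → Valuation m)
    (B : Measure (BidProfile n m)) : ℝ≥0∞ :=
  ∫⁻ b, ∫⁻ X, (welfare v X : ℝ≥0∞) ∂(A.law b) ∂B

/-- The correlated price of anarchy for `MPH`-`k` bidders: the supremum, over all profiles of
`MPH`-`k` valuations and all correlated equilibria, of the ratio of the optimal welfare to the
expected welfare at equilibrium. Here `x / 0 = ∞` for `x > 0`, and `0 / 0 = 0`. -/
def correlatedPoA {n m : ℕ} (A : AllocationRule n m) (k : ℕ) : ℝ≥0∞ :=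
  sSup {r | ∃ (v : Fin n → Valuation m) (B : Measure (BidProfile n m)),
    (∀ i, IsMPH k (v i)) ∧ IsCorrelatedEq A v B ∧
    r = (optWelfare v : ℝ≥0∞) / expWelfare A v B}

/-! ### Bayes-Nash equilibria -/

/-- A (mixed) strategy: a law of the own bid vector for every own valuation. -/
abbrev Strategy (m : ℕ) : Type := Kernel (Valuation m) (Bid m)

/-- The law of the bid profile from the point of view of bidder `i` of valuation `v`: her own bids
follow `σ i v`; every other bidder `l` independently draws a valuation from `F l` and then bids
according to `σ l`. -/
def interimLaw {n m : ℕ} (F : Fin n → Measure (Valuation m)) (σ : Fin n → Strategy m)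
    (i : Fin n) (v : Valuation m) : Measure (BidProfile n m) :=
  Measure.pi (Function.update (fun l => (F l).bind (σ l)) i (σ i v))

/-- The strategy profile `σ` is a Bayes-Nash equilibrium for valuations drawn independently from
the laws `F i`: for almost every own valuation, no bidder can gain by deviating to another bid
vector. (As bidding zero gives utility at least `0`, equilibrium utilities are finite.) -/
def IsBayesNashEq {n m : ℕ} (A : AllocationRule n m) (F : Fin n → Measure (Valuation m))
    (σ : Fin n → Strategy m) : Prop :=
  (∀ i, IsMarkovKernel (σ i)) ∧
  ∀ i, ∀ᵐ v ∂(F i), Integrable (fun b => utility A i v b) (interimLaw F σ i v) ∧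
    ∀ d : Bid m, ∫ b, utility A i v (Function.update b i d) ∂(interimLaw F σ i v)
      ≤ ∫ b, utility A i v b ∂(interimLaw F σ i v)

/-- The joint law of all valuations and bids: independently across bidders, bidder `i` draws a
valuation from `F i` and then a bid vector from `σ i`. -/
def jointLaw {n m : ℕ} (F : Fin n → Measure (Valuation m)) (σ : Fin n → Strategy m) :
    Measure (Fin n → Valuation m × Bid m) :=
  Measure.pi fun i => (F i).compProd (σ i)

/-- The expected welfare under the strategy profile `σ`. -/
def bayesWelfare {n m : ℕ} (A : AllocationRule n m) (F : Fin n → Measure (Valuation m))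
    (σ : Fin n → Strategy m) : ℝ≥0∞ :=
  ∫⁻ p, ∫⁻ X, (welfare (fun i => (p i).1) X : ℝ≥0∞) ∂(A.law fun i => (p i).2) ∂(jointLaw F σ)

/-- The expected optimal welfare. -/
def bayesOpt {n m : ℕ} (F : Fin n → Measure (Valuation m)) : ℝ≥0∞ :=
  ∫⁻ v, (optWelfare v : ℝ≥0∞) ∂(Measure.pi F)

/-- The Bayes-Nash price of anarchy for `MPH`-`k` bidders: the supremum, over all independent prior
distributions of `MPH`-`k` valuations and all Bayes-Nash equilibria, of the ratio of the expected
optimal welfare to the expected welfare at equilibrium. Here `x / 0 = ∞` for `x > 0`, `0 / 0 = 0`,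
and `∞ / x = ∞` for `x < ∞`; the ratio of two infinite expectations is discarded (set to `0`). -/
def bayesNashPoA {n m : ℕ} (A : AllocationRule n m) (k : ℕ) : ℝ≥0∞ :=
  sSup {r | ∃ (F : Fin n → Measure (Valuation m)) (σ : Fin n → Strategy m),
    (∀ i, IsProbabilityMeasure (F i)) ∧ (∀ i, ∀ᵐ v ∂(F i), IsMPH k v) ∧
    IsBayesNashEq A F σ ∧ r = bayesOpt F / bayesWelfare A F σ}

end ItemAuction

end

/-!
Every bidder's own valuation, together with the bundle `S` that an optimal allocation would give
her, suggests a deviation. Let `h` be the hypergraph weights of a `PH`-`k` function that supports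
her valuation `v` at `S`, and let `w j` be the weight of the hyperedges inside `S` through item `j`.
She bids `t * w j` on every item `j`, with one common `t` drawn uniformly from `[0, 1 / k]`. As a
hyperedge has at most `k` items, `∑ j, w j ≤ k * v S`, so she pays at most `v S / 2` on average. A
hyperedge is lost only if one of its items `j` is lost, that is if `t * w j` is at most the highest
rival bid `p j`; this has probability at most `k * p j / w j`, so she loses at most
`k * ∑ j ∈ S, p j` in value. Her utility from deviating is thus at least
`v S / 2 - k * ∑ j ∈ S, p j`. The deviations for fixed `t` are constant bid vectors, so none of
them is profitable in equilibrium and this is a lower bound on the equilibrium utility. The proof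
puts `t` on a grid of `N` points and lets `N → ∞`, which needs only finite averages
(`IsMPH.exists_weights`, `IsMPH.exists_deviations`, `IsMPH.value_add_payment_le`).

Summed over the bidders, with `O` the optimal welfare, `W` the equilibrium welfare and `R` the
revenue, which is the expected sum of the highest bids, this says `O / 2 ≤ W - R + k * R`. Bidding
zero shows `R ≤ W`, and hence `O ≤ 2 * k * W`. The sums over bidders and the integrals over the
prior are taken in `ℝ≥0∞` with payments moved to the other side, so infinite expectations are
harmless there, and `R` is cancelled only once it is known to be finite (`le_two_mul_of_add_le`).

With incomplete information, the interim expectation of a rival bid does not depend on the own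
valuation and is at most the unconditional expectation `C j` of the highest bid on `j`. The bound
therefore holds for almost every valuation profile with the constants `C j`, the bundle being chosen
from an optimal allocation for that profile, and integrating it over the profile gives the same
inequality between `O`, `W` and `R`. The interim laws are related to the joint law by resampling one
coordinate of a product measure (`lintegral_lintegral_interimLaw`).
-/

open MeasureTheory ProbabilityTheory
open scoped NNReal ENNReal

noncomputable section

namespace ItemAuction

variable {n m : ℕ}

instance (A : AllocationRule n m) : IsMarkovKernel A.law := A.isMarkov

/-! ### Bidding weights of a positive hypergraph function -/

/-- The weights that drive the deviation: split a supporting `PH`-`k` function of `v` at `S` into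
hyperedges, and let `w j` be the total weight of the hyperedges inside `S` through `j`. A hyperedge
is counted at most `k` times in `∑ j, w j`, and it is lost only if one of its items is lost. -/
lemma IsMPH.exists_weights {k : ℕ} {v : Valuation m} (hv : IsMPH k v) (S : Finset (Fin m)) :
    ∃ w : Fin m → ℝ≥0, (∀ j, j ∉ S → w j = 0) ∧ ∑ j, (w j : ℝ) ≤ k * v S ∧
      ∀ W : Finset (Fin m), (v S : ℝ) ≤ v W + ∑ j ∈ Wᶜ, (w j : ℝ) := by
  obtain ⟨-, L, hL, hmax⟩ := hv
  obtain ⟨⟨f, hfL, hfS⟩, -⟩ := hmax S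
  obtain ⟨h, ⟨h0, hrep⟩, hpos, hcard⟩ := hL f hfL
  have hle : ∀ W, (f W : ℝ) ≤ v W := fun W => by
    exact_mod_cast (hmax W).2 ⟨f, hfL, rfl⟩
  have hw : ∀ j, 0 ≤ ∑ T ∈ S.powerset with j ∈ T, h T :=
    fun j => Finset.sum_nonneg fun T _ => hpos T
  refine ⟨fun j => (∑ T ∈ S.powerset with j ∈ T, h T).toNNReal, ?_, ?_, ?_⟩
  · intro j hj
    refine Real.toNNReal_eq_zero.2 (Finset.sum_eq_zero fun T hT => ?_).le
    simp only [Finset.mem_filter, Finset.mem_powerset] at hT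
    exact absurd (hT.1 hT.2) hj
  · simp only [Real.coe_toNNReal _ (hw _)]
    rw [← hfS, hrep S, Finset.mul_sum]
    simp_rw [Finset.sum_filter]
    rw [Finset.sum_comm]
    refine Finset.sum_le_sum fun T _ => ?_
    rw [← Finset.sum_filter, Finset.sum_const, nsmul_eq_mul, Finset.filter_univ_mem]
    by_cases hT : h T = 0
    · simp [hT]
    · exact mul_le_mul_of_nonneg_right (by exact_mod_cast hcard T hT) (hpos T)
  · intro W
    simp only [Real.coe_toNNReal _ (hw _)]
    refine le_trans ?_ (add_le_add_left (hle W) _)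
    rw [← hfS, hrep S, hrep W]
    simp_rw [Finset.sum_filter]
    rw [Finset.sum_comm, ← Finset.sum_filter_add_sum_filter_not S.powerset (· ⊆ W)]
    refine add_le_add ?_ ?_
    · refine Finset.sum_le_sum_of_subset_of_nonneg ?_ fun T _ _ => hpos T
      intro T hT
      simpa using (Finset.mem_filter.1 hT).2
    · rw [Finset.sum_filter]
      refine Finset.sum_le_sum fun T _ => ?_
      split_ifs with hT
      · refine Finset.sum_nonneg fun j _ => ?_
        split_ifs
        · exact hpos T
        · exact le_rfl
      · obtain ⟨j, hjT, hjW⟩ := Finset.not_subset.1 hT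
        refine le_trans ?_ (Finset.single_le_sum (f := fun j => if j ∈ T then h T else 0)
          (fun a _ => ?_) (Finset.mem_compl.2 hjW))
        · simp [hjT]
        · split_ifs
          · exact hpos T
          · exact le_rfl

/-! ### Expected values, payments and prices -/

/-- The value that bidder `i` with valuation `v` obtains at the bid profile `b`, in expectation
over the tie-breaking. -/
def expValue (A : AllocationRule n m) (i : Fin n) (v : Valuation m) (b : BidProfile n m) : ℝ≥0∞ :=
  ∫⁻ X, (v (bundle X i) : ℝ≥0∞) ∂(A.law b)

/-- The payment of bidder `i` at the bid profile `b`, in expectation over the tie-breaking. -/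
def expPayment (A : AllocationRule n m) (i : Fin n) (b : BidProfile n m) : ℝ≥0∞ :=
  ∫⁻ X, ∑ j ∈ bundle X i, (b i j : ℝ≥0∞) ∂(A.law b)

/-- The highest bid on item `j`. -/
def topBid (b : BidProfile n m) (j : Fin m) : ℝ≥0 :=
  Finset.univ.sup fun l => b l j

/-- The highest bid on item `j` among the rivals of bidder `i`; it is `0` if there are none. -/
def rivalBid (i : Fin n) (b : BidProfile n m) (j : Fin m) : ℝ≥0 :=
  topBid (Function.update b i 0) j

lemma le_topBid (b : BidProfile n m) (l : Fin n) (j : Fin m) : b l j ≤ topBid b j :=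
  Finset.le_sup (f := fun l => b l j) (Finset.mem_univ l)

lemma le_rivalBid {i l : Fin n} (h : l ≠ i) (b : BidProfile n m) (j : Fin m) :
    b l j ≤ rivalBid i b j := by
  have := le_topBid (Function.update b i 0) l j
  rwa [Function.update_of_ne h] at this

lemma rivalBid_le_topBid (i : Fin n) (b : BidProfile n m) (j : Fin m) :
    rivalBid i b j ≤ topBid b j := by
  unfold rivalBid topBid
  refine Finset.sup_mono_fun fun l _ => ?_
  by_cases h : l = i
  · simp [h]
  · rw [Function.update_of_ne h]

lemma measurable_topBid (j : Fin m) : Measurable fun b : BidProfile n m => topBid b j := by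
  have h : (fun b : BidProfile n m => topBid b j) =
      Finset.univ.sup fun (l : Fin n) (b : BidProfile n m) => b l j := by
    ext b; simp [topBid, Finset.sup_apply]
  rw [h]
  refine Finset.sup_induction (p := Measurable) measurable_const (fun f hf g hg => hf.sup hg) ?_
  intro l _
  fun_prop

lemma measurable_rivalBid (i : Fin n) (j : Fin m) :
    Measurable fun b : BidProfile n m => rivalBid i b j :=
  (measurable_topBid j).comp measurable_update_left

lemma measurable_law_singleton (A : AllocationRule n m) (X : Allocation n m) :
    Measurable fun b => A.law b {X} :=
  A.law.measurable_coe (measurableSet_singleton X)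

lemma measurable_expValue_prod (A : AllocationRule n m) (i : Fin n) :
    Measurable fun p : Valuation m × BidProfile n m => expValue A i p.1 p.2 := by
  simp only [expValue, lintegral_fintype]
  refine Finset.measurable_sum _ fun X _ => Measurable.mul ?_ ?_
  · fun_prop
  · exact (measurable_law_singleton A X).comp measurable_snd

lemma measurable_expValue (A : AllocationRule n m) (i : Fin n) (v : Valuation m) :
    Measurable fun b => expValue A i v b :=
  (measurable_expValue_prod A i).comp measurable_prodMk_left

lemma measurable_expPayment (A : AllocationRule n m) (i : Fin n) :
    Measurable fun b => expPayment A i b := by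
  simp only [expPayment, lintegral_fintype]
  refine Finset.measurable_sum _ fun X _ => Measurable.mul ?_ (measurable_law_singleton A X)
  fun_prop

lemma expValue_le (A : AllocationRule n m) (i : Fin n) (v : Valuation m) (b : BidProfile n m) :
    expValue A i v b ≤ (Finset.univ.sup v : ℝ≥0) := by
  calc expValue A i v b ≤ ∫⁻ _, ((Finset.univ.sup v : ℝ≥0) : ℝ≥0∞) ∂(A.law b) :=
        lintegral_mono fun X =>
          ENNReal.coe_le_coe.2 (Finset.le_sup (f := v) (Finset.mem_univ (bundle X i)))
    _ = _ := by simp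

lemma expPayment_ne_top (A : AllocationRule n m) (i : Fin n) (b : BidProfile n m) :
    expPayment A i b ≠ ∞ := by
  rw [expPayment, lintegral_fintype]
  refine ENNReal.sum_ne_top.2 fun X _ => ENNReal.mul_ne_top ?_ (measure_ne_top _ _)
  exact ENNReal.sum_ne_top.2 fun j _ => ENNReal.coe_ne_top

lemma utility_eq (A : AllocationRule n m) (i : Fin n) (v : Valuation m) (b : BidProfile n m) :
    utility A i v b = (expValue A i v b).toReal - (expPayment A i b).toReal := by
  rw [utility, integral_sub Integrable.of_finite Integrable.of_finite, expValue, expPayment,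
    ← integral_toReal (by fun_prop) (by simp), ← integral_toReal (by fun_prop)
      (by simp [ENNReal.sum_lt_top])]
  congr 1
  refine integral_congr_ae (Filter.Eventually.of_forall fun X => ?_)
  simp [ENNReal.toReal_sum]

lemma integrable_expValue (A : AllocationRule n m) (i : Fin n) (v : Valuation m)
    (B : Measure (BidProfile n m)) [IsFiniteMeasure B] :
    Integrable (fun b => (expValue A i v b).toReal) B := by
  refine Integrable.of_bound (measurable_expValue A i v).ennreal_toReal.aestronglyMeasurable
    (Finset.univ.sup v : ℝ≥0) (Filter.Eventually.of_forall fun b => ?_)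
  rw [Real.norm_of_nonneg ENNReal.toReal_nonneg]
  exact ENNReal.toReal_mono ENNReal.coe_ne_top (expValue_le A i v b)

lemma integrable_utility_update (A : AllocationRule n m) (i : Fin n) (v : Valuation m)
    (B : Measure (BidProfile n m)) [IsFiniteMeasure B] (d : Bid m) :
    Integrable (fun b => utility A i v (Function.update b i d)) B := by
  have hmeas : Measurable fun b : BidProfile n m => Function.update b i d :=
    measurable_update_left
  simp only [utility_eq]
  refine Integrable.sub ?_ ?_
  · refine Integrable.of_bound
      ((measurable_expValue A i v).comp hmeas).ennreal_toReal.aestronglyMeasurable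
      (Finset.univ.sup v : ℝ≥0) (Filter.Eventually.of_forall fun b => ?_)
    rw [Real.norm_of_nonneg ENNReal.toReal_nonneg]
    exact ENNReal.toReal_mono ENNReal.coe_ne_top (expValue_le A i v _)
  · refine Integrable.of_bound
      ((measurable_expPayment A i).comp hmeas).ennreal_toReal.aestronglyMeasurable
      (∑ j, d j : ℝ≥0) (Filter.Eventually.of_forall fun b => ?_)
    rw [Real.norm_of_nonneg ENNReal.toReal_nonneg]
    refine ENNReal.toReal_mono (b := ((∑ j, d j : ℝ≥0) : ℝ≥0∞)) ENNReal.coe_ne_top ?_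
    calc expPayment A i (Function.update b i d)
        ≤ ∫⁻ _, ((∑ j, d j : ℝ≥0) : ℝ≥0∞) ∂(A.law (Function.update b i d)) := by
          refine lintegral_mono fun X => ?_
          simp only [Function.update_self]
          exact_mod_cast Finset.sum_le_univ_sum_of_nonneg (f := d) fun j => zero_le
      _ = _ := by simp

/-! ### The deviation of one bidder -/

/-- Bidding `t * w j` on every item `j`: an item that is lost has a rival bid of at least
`t * w j`. -/
lemma le_utility_update (A : AllocationRule n m) (i : Fin n) {v : Valuation m}
    {S : Finset (Fin m)} {w : Fin m → ℝ≥0}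
    (hw : ∀ W : Finset (Fin m), (v S : ℝ) ≤ v W + ∑ j ∈ Wᶜ, (w j : ℝ))
    (t : ℝ≥0) (b : BidProfile n m) :
    (v S : ℝ) - t * ∑ j, (w j : ℝ) - ∑ j, (if t * w j ≤ rivalBid i b j then (w j : ℝ) else 0)
      ≤ utility A i v (Function.update b i fun j => t * w j) := by
  set b' : BidProfile n m := Function.update b i fun j => t * w j with hb'
  have hconst : ∀ c : ℝ, ∫ _, c ∂(A.law b') = c := fun c => by simp
  rw [utility, ← hconst (_ - _)]
  refine integral_mono_ae Integrable.of_finite Integrable.of_finite ?_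
  filter_upwards [A.highest b'] with X hX
  have hpay : ∑ j ∈ bundle X i, (b' i j : ℝ) ≤ t * ∑ j, (w j : ℝ) := by
    rw [Finset.mul_sum]
    simp only [hb', Function.update_self, NNReal.coe_mul]
    exact Finset.sum_le_univ_sum_of_nonneg fun j => by positivity
  have hlost : ∑ j ∈ (bundle X i)ᶜ, (w j : ℝ)
      ≤ ∑ j, (if t * w j ≤ rivalBid i b j then (w j : ℝ) else 0) := by
    rw [← Finset.sum_filter]
    refine Finset.sum_le_sum_of_subset_of_nonneg (fun j hj => ?_) fun j _ _ => by positivity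
    have hne : X j ≠ i := by simpa [bundle] using hj
    refine Finset.mem_filter.2 ⟨Finset.mem_univ j, ?_⟩
    have := hX j i
    simp only [hb', Function.update_self, Function.update_of_ne hne] at this
    exact this.trans (le_rivalBid hne b j)
  have := hw (bundle X i)
  linarith

/-- For `c > 0`: among the multiples `c, 2 c, …, N c`, at most `x / c` do not exceed `x`. -/
lemma mul_card_multiples_le (N : ℕ) (c x : ℝ) (hx : 0 ≤ x) :
    c * ((Finset.Icc 1 N).filter fun s : ℕ => (s : ℝ) * c ≤ x).card ≤ x := by
  rcases le_or_gt c 0 with hc | hc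
  · exact (mul_nonpos_of_nonpos_of_nonneg hc (Nat.cast_nonneg _)).trans hx
  have hsub : ((Finset.Icc 1 N).filter fun s : ℕ => (s : ℝ) * c ≤ x) ⊆
      Finset.Icc 1 ⌊x / c⌋₊ := by
    intro s hs
    simp only [Finset.mem_filter, Finset.mem_Icc] at hs ⊢
    exact ⟨hs.1.1, Nat.le_floor ((le_div_iff₀ hc).2 hs.2)⟩
  have hcard := Finset.card_le_card hsub
  rw [Nat.card_Icc, Nat.add_sub_cancel] at hcard
  calc c * ((Finset.Icc 1 N).filter fun s : ℕ => (s : ℝ) * c ≤ x).card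
      ≤ c * (x / c) := by
        refine mul_le_mul_of_nonneg_left ?_ hc.le
        exact (Nat.cast_le.2 hcard).trans (Nat.floor_le (by positivity))
    _ = x := by field_simp

/-- The smoothness inequality, in discretized form: `t` is uniform on the grid
`1 / (N k), …, N / (N k)` instead of on `[0, 1 / k]`. The mean of `t` is `(N + 1) / (2 N k)`, and
the chance that `t * w j` is at most the price `p` is at most `k * p / w j`. -/
lemma IsMPH.exists_deviations {k : ℕ} (hk : 1 ≤ k) (A : AllocationRule n m) (i : Fin n)
    {v : Valuation m} (hv : IsMPH k v) (S : Finset (Fin m)) (N : ℕ) (hN : 1 ≤ N) :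
    ∃ d : ℕ → Bid m, ∀ b : BidProfile n m,
      ((N : ℝ) - 1) / 2 * v S - N * k * ∑ j ∈ S, (rivalBid i b j : ℝ)
        ≤ ∑ s ∈ Finset.Icc 1 N, utility A i v (Function.update b i (d s)) := by
  obtain ⟨w, hwS, hwsum, hw⟩ := hv.exists_weights S
  have hk' : (0 : ℝ) < k := by exact_mod_cast hk
  have hN' : (0 : ℝ) < N := by exact_mod_cast hN
  refine ⟨fun s j => (s / (N * k) : ℝ≥0) * w j, fun b => ?_⟩
  refine le_trans ?_ (Finset.sum_le_sum fun s _ => le_utility_update A i hw (s / (N * k)) b)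
  rw [Finset.sum_sub_distrib, Finset.sum_sub_distrib, Finset.sum_const, Nat.card_Icc,
    Nat.add_sub_cancel, nsmul_eq_mul, ← Finset.sum_mul, Finset.sum_comm]
  have hmean : ∑ s ∈ Finset.Icc 1 N, ((s / (N * k) : ℝ≥0) : ℝ) = (N + 1) / (2 * k) := by
    have hgauss : ∀ M : ℕ, ∑ s ∈ Finset.Icc 1 M, (s : ℝ) = M * (M + 1) / 2 := by
      intro M
      induction M with
      | zero => simp
      | succ M ih =>
        rw [Finset.sum_Icc_succ_top (by omega), ih]
        push_cast
        ring
    push_cast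
    rw [← Finset.sum_div, hgauss]
    field_simp
  have hlost : ∑ j, ∑ s ∈ Finset.Icc 1 N,
      (if (s / (N * k) : ℝ≥0) * w j ≤ rivalBid i b j then (w j : ℝ) else 0)
        ≤ N * k * ∑ j ∈ S, (rivalBid i b j : ℝ) := by
    rw [Finset.mul_sum, ← Finset.sum_subset (Finset.subset_univ S)
      fun j _ hj => by simp [hwS j hj]]
    refine Finset.sum_le_sum fun j _ => ?_
    rw [← Finset.sum_filter, Finset.sum_const, nsmul_eq_mul, mul_comm]
    have hiff : ∀ s : ℕ, (s / (N * k) : ℝ≥0) * w j ≤ rivalBid i b j ↔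
        (s : ℝ) * w j ≤ N * k * rivalBid i b j := fun s => by
      rw [← NNReal.coe_le_coe]
      push_cast
      rw [div_mul_eq_mul_div, div_le_iff₀ (by positivity), mul_comm (rivalBid i b j : ℝ)]
    simp only [hiff]
    exact mul_card_multiples_le N (w j) (N * k * rivalBid i b j) (by positivity)
  have hpay : ((N : ℝ) + 1) / (2 * k) * ∑ j, (w j : ℝ) ≤ (N + 1) / 2 * v S := by
    calc ((N : ℝ) + 1) / (2 * k) * ∑ j, (w j : ℝ) ≤ (N + 1) / (2 * k) * (k * v S) :=
          mul_le_mul_of_nonneg_left hwsum (by positivity)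
      _ = _ := by field_simp
  rw [hmean]
  linarith

/-! ### Consequences of the equilibrium conditions of one bidder -/

section Equilibrium

variable {A : AllocationRule n m} {i : Fin n} {v : Valuation m} {B : Measure (BidProfile n m)}
  [IsProbabilityMeasure B]

lemma lintegral_expValue_ne_top : ∫⁻ b, expValue A i v b ∂B ≠ ∞ :=
  ne_top_of_le_ne_top (b := ((Finset.univ.sup v : ℝ≥0) : ℝ≥0∞)) ENNReal.coe_ne_top
    ((lintegral_mono fun b => expValue_le A i v b).trans_eq
      (by rw [lintegral_const, measure_univ, mul_one]))

lemma lintegral_expPayment_ne_top (hint : Integrable (fun b => utility A i v b) B) :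
    ∫⁻ b, expPayment A i b ∂B ≠ ∞ := by
  have h : Integrable (fun b => (expPayment A i b).toReal) B := by
    refine ((integrable_expValue A i v B).sub hint).congr (Filter.Eventually.of_forall fun b => ?_)
    simp [utility_eq]
  exact (integrable_toReal_iff (measurable_expPayment A i).aemeasurable
    (Filter.Eventually.of_forall fun b => expPayment_ne_top A i b)).1 h

lemma integral_utility_eq (hint : Integrable (fun b => utility A i v b) B) :
    ∫ b, utility A i v b ∂B
      = (∫⁻ b, expValue A i v b ∂B).toReal - (∫⁻ b, expPayment A i b ∂B).toReal := by
  have hV := integrable_expValue A i v B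
  have hP : Integrable (fun b => (expPayment A i b).toReal) B :=
    integrable_toReal_of_lintegral_ne_top (measurable_expPayment A i).aemeasurable
      (lintegral_expPayment_ne_top hint)
  simp only [utility_eq]
  rw [integral_sub hV hP, integral_toReal (measurable_expValue A i v).aemeasurable
      (Filter.Eventually.of_forall fun b => (expValue_le A i v b).trans_lt ENNReal.coe_lt_top),
    integral_toReal (measurable_expPayment A i).aemeasurable
      (Filter.Eventually.of_forall fun b => (expPayment_ne_top A i b).lt_top)]

/-- Individual rationality: bidding zero is a deviation of nonnegative utility. -/
lemma lintegral_expPayment_le (hint : Integrable (fun b => utility A i v b) B)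
    (hdev : ∀ d : Bid m, ∫ b, utility A i v (Function.update b i d) ∂B
      ≤ ∫ b, utility A i v b ∂B) :
    ∫⁻ b, expPayment A i b ∂B ≤ ∫⁻ b, expValue A i v b ∂B := by
  rw [← ENNReal.toReal_le_toReal (lintegral_expPayment_ne_top hint) lintegral_expValue_ne_top]
  have h0 : 0 ≤ ∫ b, utility A i v (Function.update b i 0) ∂B :=
    integral_nonneg fun b => integral_nonneg fun X => by simp
  have := h0.trans (hdev 0)
  rw [integral_utility_eq hint] at this
  linarith

/-- In equilibrium, the value of any bundle `S` is at most twice the equilibrium utility plus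
`2 k` times the expected rival bids on `S` (with the payment moved to the left-hand side). -/
lemma IsMPH.value_add_payment_le {k : ℕ} (hk : 1 ≤ k) (hv : IsMPH k v)
    (hint : Integrable (fun b => utility A i v b) B)
    (hdev : ∀ d : Bid m, ∫ b, utility A i v (Function.update b i d) ∂B
      ≤ ∫ b, utility A i v b ∂B) (S : Finset (Fin m)) :
    (v S : ℝ≥0∞) + 2 * ∫⁻ b, expPayment A i b ∂B
      ≤ 2 * ∫⁻ b, expValue A i v b ∂B + 2 * k * ∑ j ∈ S, ∫⁻ b, rivalBid i b j ∂B := by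
  by_cases hR : ∑ j ∈ S, ∫⁻ b, (rivalBid i b j : ℝ≥0∞) ∂B = ∞
  · have : (2 * k : ℝ≥0∞) ≠ 0 := by simp; omega
    rw [hR, ENNReal.mul_top this]
    simp
  have hRj : ∀ j ∈ S, ∫⁻ b, (rivalBid i b j : ℝ≥0∞) ∂B ≠ ∞ := ENNReal.sum_ne_top.1 hR
  have hmeas : ∀ j, Measurable fun b : BidProfile n m => (rivalBid i b j : ℝ≥0∞) :=
    fun j => (measurable_rivalBid i j).coe_nnreal_ennreal
  have hRint : ∀ j ∈ S, Integrable (fun b => (rivalBid i b j : ℝ)) B := fun j hj =>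
    integrable_toReal_of_lintegral_ne_top (hmeas j).aemeasurable (hRj j hj)
  have hRtoReal : (∑ j ∈ S, ∫⁻ b, (rivalBid i b j : ℝ≥0∞) ∂B).toReal
      = ∑ j ∈ S, ∫ b, (rivalBid i b j : ℝ) ∂B := by
    rw [ENNReal.toReal_sum hRj]
    refine Finset.sum_congr rfl fun j _ => ?_
    rw [← integral_toReal (hmeas j).aemeasurable (Filter.Eventually.of_forall fun b => by simp)]
    simp
  have key : ∀ N : ℕ, 1 ≤ N → ((N : ℝ) - 1) / 2 * v S
      - N * k * ∑ j ∈ S, ∫ b, (rivalBid i b j : ℝ) ∂B ≤ N * ∫ b, utility A i v b ∂B := by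
    intro N hN
    obtain ⟨d, hd⟩ := hv.exists_deviations hk A i S N hN
    have hdint := fun s => integrable_utility_update A i v B (d s)
    calc ((N : ℝ) - 1) / 2 * v S - N * k * ∑ j ∈ S, ∫ b, (rivalBid i b j : ℝ) ∂B
        = ∫ b, (((N : ℝ) - 1) / 2 * v S - N * k * ∑ j ∈ S, (rivalBid i b j : ℝ)) ∂B := by
          rw [integral_sub (integrable_const _)
            ((integrable_finsetSum _ hRint).const_mul _), integral_const, probReal_univ, one_smul,
            integral_const_mul, integral_finsetSum _ hRint]
      _ ≤ ∫ b, ∑ s ∈ Finset.Icc 1 N, utility A i v (Function.update b i (d s)) ∂B :=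
          integral_mono ((integrable_const _).sub
            ((integrable_finsetSum _ hRint).const_mul _))
            (integrable_finsetSum _ fun s _ => hdint s) hd
      _ = ∑ s ∈ Finset.Icc 1 N, ∫ b, utility A i v (Function.update b i (d s)) ∂B :=
          integral_finsetSum _ fun s _ => hdint s
      _ ≤ ∑ s ∈ Finset.Icc 1 N, ∫ b, utility A i v b ∂B :=
          Finset.sum_le_sum fun s _ => hdev (d s)
      _ = N * ∫ b, utility A i v b ∂B := by simp
  -- the discretization error is `v S / N`, which vanishes as `N → ∞`
  have hreal : (v S : ℝ) ≤ 2 * ∫ b, utility A i v b ∂B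
      + 2 * k * ∑ j ∈ S, ∫ b, (rivalBid i b j : ℝ) ∂B := by
    by_contra! hlt
    obtain ⟨N, hN⟩ := exists_nat_gt ((v S : ℝ) / (v S - (2 * ∫ b, utility A i v b ∂B
      + 2 * k * ∑ j ∈ S, ∫ b, (rivalBid i b j : ℝ) ∂B)))
    rw [div_lt_iff₀ (sub_pos.2 hlt)] at hN
    have hN1 : 1 ≤ N := by
      rcases Nat.eq_zero_or_pos N with rfl | h
      · simp only [Nat.cast_zero, zero_mul] at hN
        exact absurd hN (not_lt.2 (v S).coe_nonneg)
      · exact h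
    nlinarith [key N hN1]
  have hP := lintegral_expPayment_ne_top hint
  have hV : ∫⁻ b, expValue A i v b ∂B ≠ ∞ := lintegral_expValue_ne_top
  rw [integral_utility_eq hint, ← hRtoReal] at hreal
  have h2P := ENNReal.mul_ne_top ENNReal.ofNat_ne_top hP (a := 2)
  have h2V := ENNReal.mul_ne_top ENNReal.ofNat_ne_top hV (a := 2)
  have h2R := ENNReal.mul_ne_top
    (ENNReal.mul_ne_top ENNReal.ofNat_ne_top (ENNReal.natCast_ne_top k)) hR (a := 2 * k)
  rw [← ENNReal.toReal_le_toReal (ENNReal.add_ne_top.2 ⟨ENNReal.coe_ne_top, h2P⟩)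
      (ENNReal.add_ne_top.2 ⟨h2V, h2R⟩), ENNReal.toReal_add ENNReal.coe_ne_top h2P,
    ENNReal.toReal_add h2V h2R]
  simp only [ENNReal.toReal_mul, ENNReal.toReal_ofNat, ENNReal.toReal_natCast,
    ENNReal.coe_toReal]
  linarith

end Equilibrium

/-! ### Summing over the bidders -/

lemma sum_sum_bundle {M : Type*} [AddCommMonoid M] (X : Allocation n m)
    (f : Fin n → Fin m → M) : ∑ i, ∑ j ∈ bundle X i, f i j = ∑ j, f (X j) j := by
  simp_rw [bundle, Finset.sum_filter]
  rw [Finset.sum_comm]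
  simp

/-- The revenue is the sum of the highest bids. -/
lemma sum_expPayment (A : AllocationRule n m) (b : BidProfile n m) :
    ∑ i, expPayment A i b = ∑ j, (topBid b j : ℝ≥0∞) := by
  simp only [expPayment]
  rw [← lintegral_finsetSum _ fun i _ => by fun_prop]
  have h : ∀ᵐ X ∂(A.law b), ∑ i, ∑ j ∈ bundle X i, (b i j : ℝ≥0∞)
      = ∑ j, (topBid b j : ℝ≥0∞) := by
    filter_upwards [A.highest b] with X hX
    rw [sum_sum_bundle X fun i j => (b i j : ℝ≥0∞)]
    refine Finset.sum_congr rfl fun j _ => ?_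
    rw [ENNReal.coe_inj]
    exact (le_topBid b (X j) j).antisymm (Finset.sup_le fun i _ => hX j i)
  rw [lintegral_congr_ae h, lintegral_const, measure_univ, mul_one]

lemma sum_expValue (A : AllocationRule n m) (v : Fin n → Valuation m) (b : BidProfile n m) :
    ∑ i, expValue A i (v i) b = ∫⁻ X, (welfare v X : ℝ≥0∞) ∂(A.law b) := by
  simp only [expValue]
  rw [← lintegral_finsetSum _ fun i _ => by fun_prop]
  simp [welfare]

/-- Apply the bound of each bidder to her bundle in an optimal allocation. -/
lemma optWelfare_add_le [Nonempty (Allocation n m)] {v : Fin n → Valuation m} {k : ℕ}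
    {V P : Fin n → ℝ≥0∞} {C : Fin m → ℝ≥0∞}
    (h : ∀ i S, (v i S : ℝ≥0∞) + 2 * P i ≤ 2 * V i + 2 * k * ∑ j ∈ S, C j) :
    (optWelfare v : ℝ≥0∞) + 2 * ∑ i, P i ≤ 2 * ∑ i, V i + 2 * k * ∑ j, C j := by
  obtain ⟨X, -, hX⟩ := Finset.exists_mem_eq_sup Finset.univ Finset.univ_nonempty
    fun X : Allocation n m => welfare v X
  rw [optWelfare, hX, welfare, ← sum_sum_bundle X fun _ j => C j, ENNReal.ofNNReal_finsetSum]
  simp only [Finset.mul_sum, ← Finset.sum_add_distrib]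
  refine Finset.sum_le_sum fun i _ => ?_
  rw [← Finset.mul_sum]
  exact h i _

/-- The bound on the optimum, once the revenue `R` is known to be at most the welfare `W`. -/
lemma le_two_mul_of_add_le {k : ℕ} (hk : 1 ≤ k) {O W R : ℝ≥0∞}
    (h : O + 2 * R ≤ 2 * W + 2 * k * R) (hR : R ≤ W) : O ≤ 2 * k * W := by
  by_cases hW : W = ∞
  · have : (2 * k : ℝ≥0∞) ≠ 0 := by simp; omega
    rw [hW, ENNReal.mul_top this]
    exact le_top
  have hR' : 2 * R ≠ ∞ := ENNReal.mul_ne_top ENNReal.ofNat_ne_top (ne_top_of_le_ne_top hW hR)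
  obtain ⟨l, rfl⟩ := Nat.exists_eq_add_of_le hk
  refine (ENNReal.add_le_add_iff_right hR').1 (h.trans ?_)
  calc 2 * W + 2 * ((1 + l : ℕ) : ℝ≥0∞) * R = 2 * W + 2 * l * R + 2 * R := by push_cast; ring
    _ ≤ 2 * W + 2 * l * W + 2 * R := by gcongr
    _ = _ := by push_cast; ring

lemma AllocationRule.nonempty_allocation (A : AllocationRule n m) :
    Nonempty (Allocation n m) :=
  nonempty_of_isProbabilityMeasure (A.law 0)

/-! ### Correlated equilibria -/

lemma optWelfare_le_of_isCorrelatedEq {k : ℕ} (hk : 1 ≤ k) (A : AllocationRule n m)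
    {v : Fin n → Valuation m} (hv : ∀ i, IsMPH k (v i)) {B : Measure (BidProfile n m)}
    (hB : IsCorrelatedEq A v B) : (optWelfare v : ℝ≥0∞) ≤ 2 * k * expWelfare A v B := by
  obtain ⟨hprob, hB⟩ := hB
  have := A.nonempty_allocation
  have hdev : ∀ i (d : Bid m), ∫ b, utility A i (v i) (Function.update b i d) ∂B
      ≤ ∫ b, utility A i (v i) b ∂B := fun i d =>
    (hB i).2 (fun _ => d) measurable_const (integrable_utility_update A i (v i) B d)
  have hrev : ∑ i, ∫⁻ b, expPayment A i b ∂B = ∑ j, ∫⁻ b, topBid b j ∂B := by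
    rw [← lintegral_finsetSum _ fun i _ => measurable_expPayment A i,
      ← lintegral_finsetSum _ fun j _ => (measurable_topBid j).coe_nnreal_ennreal]
    exact lintegral_congr fun b => sum_expPayment A b
  have hwel : ∑ i, ∫⁻ b, expValue A i (v i) b ∂B = expWelfare A v B := by
    rw [← lintegral_finsetSum _ fun i _ => measurable_expValue A i (v i)]
    exact lintegral_congr fun b => sum_expValue A v b
  have key := optWelfare_add_le (v := v) (k := k) (C := fun j => ∫⁻ b, topBid b j ∂B)
    fun i S => ((hv i).value_add_payment_le hk (hB i).1 (hdev i) S).trans (by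
      gcongr with j
      exact rivalBid_le_topBid i _ j)
  rw [hwel, ← hrev] at key
  refine le_two_mul_of_add_le hk key ?_
  rw [← hwel]
  exact Finset.sum_le_sum fun i _ => lintegral_expPayment_le (hB i).1 (hdev i)

/-! ### Resampling one coordinate of a product measure -/

section Pi

variable {ι : Type*} [Fintype ι] [DecidableEq ι] {Ω : ι → Type*} [∀ i, MeasurableSpace (Ω i)]

/-- Replacing the `i`-th coordinate of a sample of a product by a fresh sample of the law `ρ`
changes the `i`-th factor to `ρ`. -/
lemma map_update_prod_pi (μ : ∀ i, Measure (Ω i)) [∀ i, IsProbabilityMeasure (μ i)] (i : ι)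
    (ρ : Measure (Ω i)) [IsProbabilityMeasure ρ] :
    (ρ.prod (Measure.pi μ)).map (fun p => Function.update p.2 i p.1)
      = Measure.pi (Function.update μ i ρ) := by
  have hprob : ∀ l, IsProbabilityMeasure (Function.update μ i ρ l) := fun l => by
    by_cases h : l = i
    · subst h; simpa
    · rw [Function.update_of_ne h]; infer_instance
  have hmeas : Measurable fun p : Ω i × (∀ l, Ω l) => Function.update p.2 i p.1 :=
    measurable_update'.comp measurable_swap
  refine (Measure.pi_eq fun s hs => ?_).symm
  rw [Measure.map_apply hmeas (MeasurableSet.univ_pi hs)]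
  have hpre : (fun p : Ω i × (∀ l, Ω l) => Function.update p.2 i p.1) ⁻¹' Set.univ.pi s
      = s i ×ˢ Set.univ.pi (Function.update s i Set.univ) := by
    ext p
    simp only [Set.mem_preimage, Set.mem_pi, Set.mem_univ, true_imp_iff, Set.mem_prod]
    constructor
    · intro h
      refine ⟨by simpa using h i, fun l => ?_⟩
      by_cases hl : l = i
      · subst hl; simp
      · simpa [hl] using h l
    · rintro ⟨h1, h2⟩ l
      by_cases hl : l = i
      · subst hl; simpa using h1
      · simpa [hl] using h2 l
  rw [hpre, Measure.prod_prod, Measure.pi_pi, ← Finset.mul_prod_erase _ _ (Finset.mem_univ i),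
    ← Finset.mul_prod_erase (a := i) Finset.univ (fun l => Function.update μ i ρ l (s l))
      (Finset.mem_univ i)]
  simp only [Function.update_self, measure_univ, one_mul]
  congr 1
  refine Finset.prod_congr rfl fun l hl => ?_
  simp [Finset.ne_of_mem_erase hl]

lemma lintegral_pi_update (μ : ∀ i, Measure (Ω i)) [∀ i, IsProbabilityMeasure (μ i)] (i : ι)
    (ρ : Measure (Ω i)) [IsProbabilityMeasure ρ] {f : (∀ i, Ω i) → ℝ≥0∞} (hf : Measurable f) :
    ∫⁻ x, f x ∂(Measure.pi (Function.update μ i ρ))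
      = ∫⁻ a, ∫⁻ x, f (Function.update x i a) ∂(Measure.pi μ) ∂ρ := by
  have hmeas : Measurable fun p : Ω i × (∀ l, Ω l) => Function.update p.2 i p.1 :=
    measurable_update'.comp measurable_swap
  rw [← map_update_prod_pi, lintegral_map hf hmeas]
  exact lintegral_prod _ (hf.comp hmeas).aemeasurable

end Pi

/-! ### Bayes-Nash equilibria -/

section BayesNash

variable {F : Fin n → Measure (Valuation m)} {σ : Fin n → Strategy m}

/-- The law of the bid profile when all valuations are drawn from the prior. -/
def bidLaw (F : Fin n → Measure (Valuation m)) (σ : Fin n → Strategy m) :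
    Measure (BidProfile n m) :=
  Measure.pi fun l => (F l).bind (σ l)

variable [∀ i, IsProbabilityMeasure (F i)] [∀ i, IsMarkovKernel (σ i)]

instance (l : Fin n) : IsProbabilityMeasure ((F l).bind (σ l)) := by
  rw [← Measure.snd_compProd]
  infer_instance

instance : IsProbabilityMeasure (bidLaw F σ) := by
  unfold bidLaw
  infer_instance

instance (i : Fin n) (v : Valuation m) : IsProbabilityMeasure (interimLaw F σ i v) := by
  have : ∀ l, IsProbabilityMeasure
      (Function.update (fun l => (F l).bind (σ l)) i (σ i v) l) := fun l => by
    by_cases h : l = i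
    · subst h; rw [Function.update_self]; infer_instance
    · rw [Function.update_of_ne h]; infer_instance
  unfold interimLaw
  infer_instance

lemma lintegral_interimLaw (i : Fin n) (v : Valuation m) {f : BidProfile n m → ℝ≥0∞}
    (hf : Measurable f) :
    ∫⁻ b, f b ∂(interimLaw F σ i v)
      = ∫⁻ c, ∫⁻ b, f (Function.update b i c) ∂(bidLaw F σ) ∂(σ i v) :=
  lintegral_pi_update _ i _ hf

lemma map_jointLaw : (jointLaw F σ).map (fun p i => (p i).2) = bidLaw F σ := by
  have hsnd : ∀ i, ((F i).compProd (σ i)).map Prod.snd = (F i).bind (σ i) :=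
    fun i => Measure.snd_compProd _ _
  have hσ : ∀ i, SigmaFinite (((F i).compProd (σ i)).map Prod.snd) := fun i => by
    rw [hsnd]; infer_instance
  have := Measure.pi_map_pi (μ := fun i => (F i).compProd (σ i)) (f := fun _ => Prod.snd)
    fun i => measurable_snd.aemeasurable
  rw [jointLaw, this, bidLaw]
  simp only [hsnd]

/-- The interim law does not change the distribution of the rivals' bids. -/
lemma lintegral_rivalBid_interimLaw (i : Fin n) (v : Valuation m) (j : Fin m) :
    ∫⁻ b, rivalBid i b j ∂(interimLaw F σ i v) = ∫⁻ b, rivalBid i b j ∂(bidLaw F σ) := by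
  rw [lintegral_interimLaw i v (measurable_rivalBid i j).coe_nnreal_ennreal]
  simp [rivalBid]

/-- Drawing the valuation of bidder `i` and then the bids from her interim law is the same as
drawing everything from the joint law. -/
lemma lintegral_lintegral_interimLaw (i : Fin n) {f : Valuation m × BidProfile n m → ℝ≥0∞}
    (hf : Measurable f) :
    ∫⁻ v, ∫⁻ b, f (v, b) ∂(interimLaw F σ i v) ∂(F i)
      = ∫⁻ p, f ((p i).1, fun l => (p l).2) ∂(jointLaw F σ) := by
  have hbids : Measurable fun (p : Fin n → Valuation m × Bid m) l => (p l).2 := by fun_prop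
  have hF : Measurable fun p : Fin n → Valuation m × Bid m =>
      f ((p i).1, fun l => (p l).2) := by fun_prop
  have hg : Measurable fun q : (Valuation m × Bid m) × BidProfile n m =>
      f (q.1.1, Function.update q.2 i q.1.2) :=
    hf.comp ((measurable_fst.comp measurable_fst).prodMk ((measurable_update' (a := i)).comp
      (measurable_snd.prodMk (measurable_snd.comp measurable_fst))))
  have hupd : ∀ (p : Fin n → Valuation m × Bid m) (a : Valuation m × Bid m),
      (fun l => (Function.update p i a l).2)
        = Function.update (fun l => (p l).2) i a.2 := fun p a => by
    ext1 l
    by_cases h : l = i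
    · subst h; simp
    · simp [h]
  calc ∫⁻ v, ∫⁻ b, f (v, b) ∂(interimLaw F σ i v) ∂(F i)
      = ∫⁻ v, ∫⁻ c, ∫⁻ b, f (v, Function.update b i c) ∂(bidLaw F σ) ∂(σ i v) ∂(F i) :=
        lintegral_congr fun v => lintegral_interimLaw i v (hf.comp measurable_prodMk_left)
    _ = ∫⁻ a, ∫⁻ b, f (a.1, Function.update b i a.2) ∂(bidLaw F σ) ∂((F i).compProd (σ i)) :=
        (Measure.lintegral_compProd (f := fun a : Valuation m × Bid m =>
          ∫⁻ b, f (a.1, Function.update b i a.2) ∂(bidLaw F σ))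
          (Measurable.lintegral_prod_right hg)).symm
    _ = ∫⁻ a, ∫⁻ p, f (a.1, Function.update (fun l => (p l).2) i a.2) ∂(jointLaw F σ)
          ∂((F i).compProd (σ i)) := by
        refine lintegral_congr fun a => ?_
        rw [← map_jointLaw]
        exact lintegral_map (hg.comp (measurable_prodMk_left (x := a))) hbids
    _ = ∫⁻ p, f ((p i).1, fun l => (p l).2) ∂(jointLaw F σ) := by
        have := lintegral_pi_update (fun i => (F i).compProd (σ i)) i ((F i).compProd (σ i)) hF
        rw [Function.update_eq_self] at this
        rw [jointLaw, this]
        simp only [Function.update_self, hupd]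

lemma measurable_lintegral_interimLaw (i : Fin n) {f : Valuation m × BidProfile n m → ℝ≥0∞}
    (hf : Measurable f) : Measurable fun v => ∫⁻ b, f (v, b) ∂(interimLaw F σ i v) := by
  have hg : Measurable fun q : (Valuation m × Bid m) × BidProfile n m =>
      f (q.1.1, Function.update q.2 i q.1.2) :=
    hf.comp ((measurable_fst.comp measurable_fst).prodMk ((measurable_update' (a := i)).comp
      (measurable_snd.prodMk (measurable_snd.comp measurable_fst))))
  have h : (fun v => ∫⁻ b, f (v, b) ∂(interimLaw F σ i v))
      = fun v => ∫⁻ c, ∫⁻ b, f (v, Function.update b i c) ∂(bidLaw F σ) ∂(σ i v) :=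
    funext fun v => lintegral_interimLaw i v (hf.comp measurable_prodMk_left)
  rw [h]
  exact Measurable.lintegral_kernel_prod_right (Measurable.lintegral_prod_right hg)

lemma lintegral_pi_eval (i : Fin n) {g : Valuation m → ℝ≥0∞} (hg : Measurable g) :
    ∫⁻ v, g (v i) ∂(Measure.pi F) = ∫⁻ w, g w ∂(F i) :=
  (measurePreserving_eval F i).lintegral_comp hg

end BayesNash

lemma bayesOpt_le_of_isBayesNashEq {k : ℕ} (hk : 1 ≤ k) (A : AllocationRule n m)
    {F : Fin n → Measure (Valuation m)} {σ : Fin n → Strategy m}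
    (hF : ∀ i, IsProbabilityMeasure (F i)) (hv : ∀ i, ∀ᵐ v ∂(F i), IsMPH k v)
    (hσ : IsBayesNashEq A F σ) : bayesOpt F ≤ 2 * k * bayesWelfare A F σ := by
  obtain ⟨hmarkov, heq⟩ := hσ
  have := A.nonempty_allocation
  set V : Fin n → Valuation m → ℝ≥0∞ := fun i w => ∫⁻ b, expValue A i w b ∂(interimLaw F σ i w)
  set P : Fin n → Valuation m → ℝ≥0∞ := fun i w => ∫⁻ b, expPayment A i b ∂(interimLaw F σ i w)
  set C : Fin m → ℝ≥0∞ := fun j => ∫⁻ b, topBid b j ∂(bidLaw F σ)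
  have hpay : ∀ i, Measurable fun p : Valuation m × BidProfile n m => expPayment A i p.2 :=
    fun i => (measurable_expPayment A i).comp measurable_snd
  have hV : ∀ i, Measurable (V i) :=
    fun i => measurable_lintegral_interimLaw i (measurable_expValue_prod A i)
  have hP : ∀ i, Measurable (P i) := fun i => measurable_lintegral_interimLaw i (hpay i)
  have hbids : Measurable fun (p : Fin n → Valuation m × Bid m) l => (p l).2 := by fun_prop
  have hwel : ∑ i, ∫⁻ w, V i w ∂(F i) = bayesWelfare A F σ := by
    simp only [V, lintegral_lintegral_interimLaw _ (measurable_expValue_prod A _)]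
    have hval : ∀ i, Measurable fun p : Fin n → Valuation m × Bid m =>
        expValue A i (p i).1 fun l => (p l).2 := fun i =>
      (measurable_expValue_prod A i).comp
        ((measurable_fst.comp (measurable_pi_apply i)).prodMk hbids)
    rw [← lintegral_finsetSum _ fun i _ => hval i]
    exact lintegral_congr fun p => sum_expValue A _ _
  have hrev : ∑ i, ∫⁻ w, P i w ∂(F i) = ∑ j, C j := by
    simp only [P, C, lintegral_lintegral_interimLaw _ (hpay _)]
    have hpay' : ∀ i, Measurable fun p : Fin n → Valuation m × Bid m =>
        expPayment A i fun l => (p l).2 := fun i => (measurable_expPayment A i).comp hbids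
    rw [← lintegral_finsetSum _ fun i _ => hpay' i,
      ← lintegral_finsetSum _ fun j _ => (measurable_topBid j).coe_nnreal_ennreal,
      ← map_jointLaw, lintegral_map (Finset.measurable_sum _ fun j _ =>
        (measurable_topBid j).coe_nnreal_ennreal) hbids]
    exact lintegral_congr fun p => sum_expPayment A _
  have hae : ∀ᵐ v ∂(Measure.pi F), (optWelfare v : ℝ≥0∞) + 2 * ∑ i, P i (v i)
      ≤ 2 * ∑ i, V i (v i) + 2 * k * ∑ j, C j := by
    have hall : ∀ᵐ v ∂(Measure.pi F), ∀ i, IsMPH k (v i) ∧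
        Integrable (fun b => utility A i (v i) b) (interimLaw F σ i (v i)) ∧
        ∀ d : Bid m, ∫ b, utility A i (v i) (Function.update b i d) ∂(interimLaw F σ i (v i))
          ≤ ∫ b, utility A i (v i) b ∂(interimLaw F σ i (v i)) :=
      ae_all_iff.2 fun i =>
        (measurePreserving_eval F i).quasiMeasurePreserving.ae ((hv i).and (heq i))
    filter_upwards [hall] with v hv
    refine optWelfare_add_le fun i S =>
      ((hv i).1.value_add_payment_le hk (hv i).2.1 (hv i).2.2 S).trans ?_
    simp only [lintegral_rivalBid_interimLaw]
    gcongr with j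
    exact lintegral_mono fun b => ENNReal.coe_le_coe.2 (rivalBid_le_topBid i b j)
  have key := lintegral_mono_ae hae
  rw [lintegral_add_right _ (by fun_prop), lintegral_add_right _ measurable_const,
    lintegral_const_mul _ (by fun_prop), lintegral_const_mul _ (by fun_prop),
    lintegral_finsetSum _ fun i _ => by fun_prop,
    lintegral_finsetSum _ fun i _ => by fun_prop, lintegral_const, measure_univ, mul_one,
    Finset.sum_congr rfl fun i _ => lintegral_pi_eval i (hP i),
    Finset.sum_congr rfl fun i _ => lintegral_pi_eval i (hV i), hwel, ← hrev] at key
  refine le_two_mul_of_add_le hk key ?_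
  rw [← hwel]
  refine Finset.sum_le_sum fun i _ => lintegral_mono_ae ?_
  filter_upwards [heq i] with w hw
  exact lintegral_expPayment_le hw.1 hw.2

end ItemAuction

end

theorem theorem3 (n m k : ℕ) (hk : 1 ≤ k) (A : ItemAuction.AllocationRule n m) :
    ItemAuction.correlatedPoA A k ≤ 2 * (k : ENNReal) ∧
      ItemAuction.bayesNashPoA A k ≤ 2 * (k : ENNReal) := by
  constructor
  · refine sSup_le ?_
    rintro r ⟨v, B, hv, hB, rfl⟩
    exact ENNReal.div_le_of_le_mul (ItemAuction.optWelfare_le_of_isCorrelatedEq hk A hv hB)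
  · refine sSup_le ?_
    rintro r ⟨F, σ, hF, hv, hσ, rfl⟩
    exact ENNReal.div_le_of_le_mul (ItemAuction.bayesOpt_le_of_isBayesNashEq hk A hF hv hσ)
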